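/- A directed set is a partially ordered set in which every finite subset (including the empty one) has an upper bound. For directed sets $P,Q$ write $P\ge_T Q$ ("$P$ Tukey quotients to $Q$", "$Q$ is below $P$") if there is a map $\phi:P\to Q$ such that $\phi(C)$ is cofinal in $Q$ for every cofinal $C\subseteq P$. A topological directed set is a directed set equipped with a topology (no separation or compatibility axioms are assumed); it is CSBS if every convergent sequence in it has a subsequence with an upper bound. Let $$\textstyle\sum\omega^{\omega_1}=\{f:\omega_1\to\omega \;:\; \{\alpha<\omega_1 : f(\alpha)\neq 0\}\text{ is countable}\},$$ ordered coordinatewise. **Proposition.** If $P$ is a second countable CSBS topological directed set, then $P\not\ge_T\sum\omega^{\omega_1}$. Consequently $D\not\ge_T\sum\omega^{\omega_1}$ for each of the following directed sets $D$: - $\omega^\omega$, with the coordinatewise order; - $\mathcal{E}_\mu$, the compact subsets of $[0,1]$ of Lebesgue measure zero, ordered by inclusion; - $\mathrm{NWD}$, the closed nowhere dense subsets, ordered by inclusion, of $X$, where $X$ is any one of the usual underlying spaces $2^\omega$, $[0,1]$, $\mathbb{R}$; - $\mathcal{Z}_0$, the subsets $A\subseteq\mathbb{N}$ of asymptotic density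 zero (that is, $|A\cap\{0,\dots,n-1\}|/n\to0$), ordered by inclusion; - $\ell_1$, the absolutely summable real sequences, with the coordinatewise order. Moreover $\sum\omega^{\omega_1}\ge_T\omega^\omega$; hence $\sum\omega^{\omega_1}$ lies strictly above $\omega^\omega$, i.e. $\sum\omega^{\omega_1}\ge_T\omega^\omega$ and $\omega^\omega\not\ge_T\sum\omega^{\omega_1}$. -/

import Mathlib

open Filter Topology MeasureTheory

open scoped Ordinal

universe u

/-- `P` Tukey quotients to `Q`: some map `P → Q` takes cofinal sets to cofinal sets. -/
def TukeyGE (P Q : Type*) [LE P] [LE Q] : Prop :=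
  ∃ φ : P → Q, ∀ C : Set P, IsCofinal C → IsCofinal (φ '' C)

/-- CSBS: every convergent sequence has a subsequence with an upper bound. -/
def CSBS (P : Type*) [LE P] [TopologicalSpace P] : Prop :=
  ∀ (x : ℕ → P) (p : P), Tendsto x atTop (𝓝 p) →
    ∃ k : ℕ → ℕ, StrictMono k ∧ BddAbove (Set.range (x ∘ k))

/-- The Σ-product of a family of directed sets with least elements: the elements of the full
product with countable support, in the coordinatewise order. -/
abbrev SigmaProduct {ι : Type*} (P : ι → Type*) [∀ i, PartialOrder (P i)] [∀ i, OrderBot (P i)] :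
    Type _ :=
  {f : ∀ i, P i // {i | f i ≠ ⊥}.Countable}

/-- The Σ-product of `ω₁` copies of `ω`. -/
abbrev SigmaOmega : Type :=
  SigmaProduct (fun _ : (ω₁ : Ordinal.{0}).ToType => ℕ)

/-- The ideal of compact Lebesgue null subsets of `[0, 1]`, ordered by inclusion. -/
abbrev EMu : Type :=
  {K : Set ℝ // K ⊆ Set.Icc 0 1 ∧ IsCompact K ∧ volume K = 0}

/-- The closed nowhere dense subsets of `X`, ordered by inclusion. (They are cofinal among
all nowhere dense subsets, as closures of nowhere dense sets are nowhere dense.) -/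
abbrev NWD (X : Type*) [TopologicalSpace X] : Type _ :=
  {A : Set X // IsClosed A ∧ IsNowhereDense A}

/-- The ideal of subsets of `ℕ` of asymptotic density zero, ordered by inclusion. -/
abbrev ZZero : Type :=
  {A : Set ℕ // Tendsto (fun n : ℕ => ((A ∩ Set.Iio n).ncard : ℝ) / n) atTop (𝓝 0)}

/-- The absolutely summable real sequences, in the coordinatewise order. -/
abbrev EllOne : Type :=
  {x : ℕ → ℝ // Summable fun n => |x n|}

theorem exists_injective_forall_mem_of_infinite {ι α : Type*} [Countable ι] (D : ι → Set α)
    (hD : ∀ i, (D i).Infinite) : ∃ a : ι → α, Function.Injective a ∧ ∀ i, a i ∈ D i := by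
  classical
  obtain ⟨e, he⟩ := exists_injective_nat ι
  -- Sizes `e i + 1` give Hall's condition: the index of `s` with largest `e` already has at least
  -- `s.card` candidates.
  choose t htD htc using fun i => (hD i).exists_subset_card_eq (e i + 1)
  have hall : ∀ s : Finset ι, s.card ≤ (s.biUnion t).card := by
    intro s
    rcases s.eq_empty_or_nonempty with rfl | hs
    · simp
    · obtain ⟨i, hi, hmax⟩ := s.exists_max_image e hs
      calc s.card = (s.image e).card := (Finset.card_image_of_injective s he).symm
        _ ≤ (Finset.range (e i + 1)).card := by
          refine Finset.card_le_card fun n hn => ?_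
          obtain ⟨j, hj, rfl⟩ := Finset.mem_image.1 hn
          exact Finset.mem_range.2 (Nat.lt_succ_of_le (hmax j hj))
        _ = (t i).card := by rw [Finset.card_range, htc]
        _ ≤ (s.biUnion t).card := Finset.card_le_card (Finset.subset_biUnion_of_mem t hi)
  obtain ⟨a, ha, hat⟩ := (Finset.all_card_le_biUnion_card_iff_exists_injective t).1 hall
  exact ⟨a, ha, fun i => htD i (hat i)⟩

/-- A Tukey quotient `P → Q` yields a map `Q → P` under which preimages of bounded sets are
bounded. -/
theorem TukeyGE.exists_bddAbove {P Q : Type*} [LE P] [LE Q] (h : TukeyGE P Q) :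
    ∃ ψ : Q → P, ∀ S : Set Q, BddAbove (ψ '' S) → BddAbove S := by
  obtain ⟨φ, hφ⟩ := h
  have key : ∀ q : Q, ∃ p : P, ∀ p', p ≤ p' → q ≤ φ p' := by
    intro q
    by_contra! hq
    have hC : IsCofinal {p' : P | ¬ q ≤ φ p'} := fun p =>
      let ⟨p', h₁, h₂⟩ := hq p
      ⟨p', h₂, h₁⟩
    obtain ⟨_, ⟨p', hp', rfl⟩, hle⟩ := hφ _ hC q
    exact hp' hle
  choose ψ hψ using key
  refine ⟨ψ, fun S ⟨p, hp⟩ => ⟨φ p, fun q hq => hψ q p (hp ⟨q, hq, rfl⟩)⟩⟩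

theorem uncountable_omega_one_toType : Uncountable (ω₁ : Ordinal.{0}).ToType := by
  rw [← Cardinal.aleph0_lt_mk_iff]
  simp

/-- A second countable CSBS topological poset does not Tukey quotient to `Σω^{ω₁}`. -/
theorem CSBS.not_tukeyGE_sigmaOmega {P : Type*} [LE P] [TopologicalSpace P]
    [SecondCountableTopology P] (hP : CSBS P) : ¬ TukeyGE P SigmaOmega := by
  intro h
  obtain ⟨ψ, hψ⟩ := h.exists_bddAbove
  have hB := TopologicalSpace.isBasis_countableBasis P
  have hBc := TopologicalSpace.countable_countableBasis P
  set B := TopologicalSpace.countableBasis P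
  let D : Set P → Set (ω₁ : Ordinal.{0}).ToType := fun U =>
    {a | ∃ N : ℕ, ∀ g : SigmaOmega, ψ g ∈ U → g.1 a ≤ N}
  have key : ∀ (f : SigmaOmega) (a), ∃ U ∈ B, ψ f ∈ U ∧ a ∈ D U := by
    intro f a
    by_contra! hcon
    -- Otherwise some `g k` with `ψ (g k) → ψ f` have `g k a > k`, so no subsequence of them is
    -- bounded at `a`.
    obtain ⟨V, hV⟩ := (𝓝 (ψ f)).exists_antitone_basis
    have hex : ∀ k : ℕ, ∃ g : SigmaOmega, ψ g ∈ V k ∧ k < g.1 a := by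
      intro k
      obtain ⟨U, hU, hfU, hUV⟩ := hB.mem_nhds_iff.1 (hV.1.mem_of_mem (i := k) trivial)
      have hna := hcon U hU hfU
      simp only [D, Set.mem_ofPred_eq, not_exists, not_forall, not_le] at hna
      obtain ⟨g, hg, hk⟩ := hna k
      exact ⟨g, hUV hg, hk⟩
    choose g hgV hgk using hex
    obtain ⟨k, hk, hbdd⟩ := hP (ψ ∘ g) (ψ f) (hV.tendsto hgV)
    have hr : Set.range ((ψ ∘ g) ∘ k) = ψ '' Set.range (g ∘ k) := by
      rw [← Set.range_comp]; rfl
    rw [hr] at hbdd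
    obtain ⟨u, hu⟩ := hψ _ hbdd
    have h₁ : g (k (u.1 a)) ≤ u := hu ⟨u.1 a, rfl⟩
    have h₂ : (g (k (u.1 a))).1 a ≤ u.1 a := h₁ a
    exact absurd ((hk.le_apply.trans_lt (hgk _)).trans_le h₂) (lt_irrefl _)
  let T : Type _ := {U : Set P // U ∈ B ∧ ¬ (D U).Countable}
  have : Countable T := (hBc.mono fun U (hU : U ∈ B ∧ ¬ (D U).Countable) => hU.1).to_subtype
  obtain ⟨a, ha, haD⟩ := exists_injective_forall_mem_of_infinite (fun U : T => D U.1)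
    fun U hfin => U.2.2 hfin.countable
  choose N hN using haD
  let f : SigmaOmega := ⟨Function.extend a (fun U => N U + 1) fun _ => 0, by
    refine (Set.countable_range a).mono fun α hα => ?_
    by_contra hnot
    exact hα (Function.extend_apply' _ _ _ hnot)⟩
  have hf : ∀ U : T, ψ f ∉ U.1 := by
    intro U hU
    have h₁ := hN U f hU
    have h₂ : f.1 (a U) = N U + 1 :=
      ha.extend_apply (fun U => N U + 1) (fun _ : (ω₁ : Ordinal.{0}).ToType => 0) U
    exact absurd (h₂.symm.trans_le h₁) (Nat.not_succ_le_self _)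
  have hcount : (⋃ U ∈ {U | U ∈ B ∧ (D U).Countable}, D U).Countable :=
    (hBc.mono fun U (hU : U ∈ B ∧ (D U).Countable) => hU.1).biUnion fun U hU => hU.2
  have := uncountable_omega_one_toType
  obtain ⟨β, hβ⟩ : ∃ β, β ∉ ⋃ U ∈ {U | U ∈ B ∧ (D U).Countable}, D U := by
    by_contra! hall
    exact Set.not_countable_univ (hcount.mono fun x _ => hall x)
  obtain ⟨U, hU, hfU, hβU⟩ := key f β
  by_cases hc : (D U).Countable
  · exact hβ (Set.mem_biUnion (show U ∈ {U | U ∈ B ∧ (D U).Countable} from ⟨hU, hc⟩) hβU)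
  · exact hf ⟨U, hU, hc⟩ hfU

/-- The criterion for the topology generated by a countable family of sets. -/
theorem not_tukeyGE_sigmaOmega_of_countable_family {P ι : Type*} [LE P] [Countable ι]
    (A : ι → Set P)
    (hA : ∀ (x : ℕ → P) (p : P), (∀ i, p ∈ A i → ∀ᶠ n in atTop, x n ∈ A i) →
      ∃ k : ℕ → ℕ, StrictMono k ∧ BddAbove (Set.range (x ∘ k))) :
    ¬ TukeyGE P SigmaOmega := by
  let : TopologicalSpace P := TopologicalSpace.generateFrom (Set.range A)
  have : SecondCountableTopology P := ⟨⟨_, Set.countable_range A, rfl⟩⟩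
  refine CSBS.not_tukeyGE_sigmaOmega fun x p hx => hA x p fun i hi => ?_
  exact hx ((TopologicalSpace.isOpen_generateFrom_of_mem (Set.mem_range_self i)).mem_nhds hi)

/-- In the product of discrete topologies a convergent sequence is bounded in each coordinate, so no
thinning is needed. -/
theorem csbs_nat_pi : CSBS (ℕ → ℕ) := by
  intro x p hx
  refine ⟨id, strictMono_id, ?_⟩
  rw [Function.comp_id, bddAbove_pi]
  intro i
  rw [← Set.range_comp]
  exact (tendsto_pi_nhds.1 hx i).bddAbove_range

/-- If every point outside a closed set `K` has a neighborhood missing `K` and all but finitely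
many of the closed sets `F n`, then `K ∪ ⋃ n, F n` is closed. -/
theorem isClosed_union_iUnion_of_eventually_disjoint {X : Type*} [TopologicalSpace X]
    {B : Set (Set X)} (hB : TopologicalSpace.IsTopologicalBasis B) {K : Set X} {F : ℕ → Set X}
    (hK : IsClosed K) (hF : ∀ n, IsClosed (F n))
    (h : ∀ U ∈ B, Disjoint K U → ∀ᶠ n in atTop, Disjoint (F n) U) :
    IsClosed (K ∪ ⋃ n, F n) := by
  rw [← isOpen_compl_iff, isOpen_iff_mem_nhds]
  intro x hx
  simp only [Set.compl_union, Set.mem_inter_iff, Set.mem_compl_iff, Set.mem_iUnion,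
    not_exists] at hx
  obtain ⟨U, hU, hxU, hUK⟩ := hB.mem_nhds_iff.1 (hK.isOpen_compl.mem_nhds hx.1)
  obtain ⟨N, hN⟩ := eventually_atTop.1 (h U hU (Set.subset_compl_iff_disjoint_left.1 hUK))
  have hfin : (⋂ n ∈ Set.Iio N, (F n)ᶜ) ∈ 𝓝 x :=
    (biInter_mem (Set.finite_Iio N)).2 fun n _ => (hF n).isOpen_compl.mem_nhds (hx.2 n)
  filter_upwards [hfin, (hB.isOpen hU).mem_nhds hxU] with y hy hyU
  simp only [Set.compl_union, Set.mem_inter_iff, Set.mem_compl_iff, Set.mem_iUnion, not_exists]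
  refine ⟨hUK hyU, fun n hn => ?_⟩
  rcases lt_or_ge n N with hnN | hnN
  · exact Set.mem_iInter₂.1 hy n hnN hn
  · exact Set.disjoint_left.1 (hN n hnN) hn hyU

/-- Ideals of closed sets stable under those countable unions that are closed. -/
theorem not_tukeyGE_sigmaOmega_of_isClosed {X : Type*} [TopologicalSpace X]
    [SecondCountableTopology X] (I : Set X → Prop) (hI : ∀ K, I K → IsClosed K)
    (hU : ∀ (K : Set X) (F : ℕ → Set X), I K → (∀ n, I (F n)) → IsClosed (K ∪ ⋃ n, F n) →
      I (K ∪ ⋃ n, F n)) :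
    ¬ TukeyGE {K // I K} SigmaOmega := by
  have := (TopologicalSpace.countable_countableBasis X).to_subtype
  refine not_tukeyGE_sigmaOmega_of_countable_family
    -- These sets generate an upper Vietoris-type topology, in which a convergent sequence together
    -- with its limit has closed union.
    (fun U : TopologicalSpace.countableBasis X => {K : {K // I K} | Disjoint K.1 U.1})
    fun x p hx => ⟨id, strictMono_id, ?_⟩
  have hcl : IsClosed (p.1 ∪ ⋃ n, (x n).1) :=
    isClosed_union_iUnion_of_eventually_disjoint (TopologicalSpace.isBasis_countableBasis X)
      (hI _ p.2) (fun n => hI _ (x n).2) fun U hU hd => hx ⟨U, hU⟩ hd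
  refine ⟨⟨_, hU _ _ p.2 (fun n => (x n).2) hcl⟩, ?_⟩
  rintro _ ⟨n, rfl⟩
  exact (Set.subset_iUnion (fun n => (x n).1) n).trans Set.subset_union_right

theorem not_tukeyGE_eMu_sigmaOmega : ¬ TukeyGE EMu SigmaOmega := by
  refine not_tukeyGE_sigmaOmega_of_isClosed
    (fun K : Set ℝ => K ⊆ Set.Icc 0 1 ∧ IsCompact K ∧ volume K = 0)
    (fun K hK => hK.2.1.isClosed) fun K F hK hF hcl => ?_
  have hsub : K ∪ ⋃ n, F n ⊆ Set.Icc 0 1 :=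
    Set.union_subset hK.1 (Set.iUnion_subset fun n => (hF n).1)
  exact ⟨hsub, isCompact_Icc.of_isClosed_subset hcl hsub,
    measure_union_null hK.2.2 (measure_iUnion_null fun n => (hF n).2.2)⟩

theorem not_tukeyGE_nwd_sigmaOmega (X : Type*) [TopologicalSpace X] [SecondCountableTopology X]
    [BaireSpace X] : ¬ TukeyGE (NWD X) SigmaOmega := by
  refine not_tukeyGE_sigmaOmega_of_isClosed (fun A : Set X => IsClosed A ∧ IsNowhereDense A)
    (fun K hK => hK.1) fun K F hK hF hcl => ⟨hcl, ?_⟩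
  -- In a Baire space a closed meagre set is nowhere dense.
  have hm : IsMeagre (K ∪ ⋃ n, F n) :=
    hK.2.isMeagre.union (isMeagre_iUnion fun n => (hF n).2.isMeagre)
  rw [IsNowhereDense, hcl.closure_eq, interior_eq_empty_iff_dense_compl]
  exact dense_of_mem_residual hm

/-- Restrict to countably many coordinates; extension by zero stays in the Σ-product. -/
theorem tukeyGE_sigmaOmega_nat_pi : TukeyGE SigmaOmega (ℕ → ℕ) := by
  have := uncountable_omega_one_toType
  let e := Infinite.natEmbedding (ω₁ : Ordinal.{0}).ToType
  refine ⟨fun f n => f.1 (e n), fun C hC g => ?_⟩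
  obtain ⟨f, hfC, hf⟩ := hC ⟨Function.extend e g fun _ => 0, by
    refine (Set.countable_range e).mono fun α hα => ?_
    by_contra hnot
    exact hα (Function.extend_apply' _ _ _ hnot)⟩
  refine ⟨_, ⟨f, hfC, rfl⟩, fun n => ?_⟩
  have h := hf (e n)
  simp only [e.injective.extend_apply] at h
  exact h

/-! ### Density zero sets -/

theorem ZZero.exists_finset_subset (p : ZZero) (m : ℕ) : ∃ F : Finset ℕ, (F : Set ℕ) ⊆ p.1 ∧
    ∀ n : ℕ, (((p.1 \ F) ∩ Set.Iio n).ncard : ℝ) ≤ (1 / 2) ^ m * n := by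
  obtain ⟨N, hN⟩ := eventually_atTop.1
    (p.2.eventually_lt_const (show (0 : ℝ) < (1 / 2) ^ m by positivity))
  have hfin : (p.1 ∩ Set.Iio N).Finite := (Set.finite_Iio N).inter_of_right _
  refine ⟨hfin.toFinset, by simp, fun n => ?_⟩
  rw [hfin.coe_toFinset]
  rcases le_or_gt n N with h | h
  · have hempty : (p.1 \ (p.1 ∩ Set.Iio N)) ∩ Set.Iio n = ∅ := by
      refine Set.eq_empty_of_forall_notMem ?_
      rintro a ⟨⟨h₁, h₂⟩, h₃⟩
      exact h₂ ⟨h₁, lt_of_lt_of_le h₃ h⟩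
    rw [hempty, Set.ncard_empty, Nat.cast_zero]
    positivity
  · have hn : (0 : ℝ) < n := by exact_mod_cast (Nat.zero_le N).trans_lt h
    refine le_trans ?_ ((div_lt_iff₀ hn).1 (hN n h.le)).le
    exact_mod_cast Set.ncard_le_ncard (Set.inter_subset_inter_left _ Set.sdiff_subset)
      ((Set.finite_Iio n).inter_of_right _)

theorem ncard_biUnion_le_sum {ι α : Type*} (s : Finset ι) (S : ι → Set α) :
    (⋃ i ∈ s, S i).ncard ≤ ∑ i ∈ s, (S i).ncard := by
  classical
  induction s using Finset.induction_on with
  | empty => simp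
  | insert i s hi ih =>
    rw [Finset.set_biUnion_insert, Finset.sum_insert hi]
    exact (Set.ncard_union_le _ _).trans (Nat.add_le_add_left ih _)

theorem tendsto_density_union_iUnion {p : Set ℕ} {x : ℕ → Set ℕ} {F : ℕ → Finset ℕ}
    (hp : Tendsto (fun n : ℕ => ((p ∩ Set.Iio n).ncard : ℝ) / n) atTop (𝓝 0))
    (hx : ∀ m, Tendsto (fun n : ℕ => ((x m ∩ Set.Iio n).ncard : ℝ) / n) atTop (𝓝 0))
    (hFp : ∀ m, (F m : Set ℕ) ⊆ p)
    (hF : ∀ m n : ℕ, (((x m \ F m) ∩ Set.Iio n).ncard : ℝ) ≤ (1 / 2) ^ m * n) :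
    Tendsto (fun n : ℕ => (((p ∪ ⋃ m, x m) ∩ Set.Iio n).ncard : ℝ) / n) atTop (𝓝 0) := by
  -- The count is an integer below `1`, so only indices `m < n` contribute below `n`.
  have hempty : ∀ m n : ℕ, n ≤ m → (x m \ F m) ∩ Set.Iio n = ∅ := by
    intro m n hmn
    have h₁ : (1 / 2 : ℝ) ^ m * n < 1 := by
      rw [div_pow, one_pow, div_mul_eq_mul_div, one_mul, div_lt_one (by positivity)]
      exact_mod_cast hmn.trans_lt m.lt_two_pow_self
    have h₂ : ((x m \ F m) ∩ Set.Iio n).ncard < 1 := by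
      exact_mod_cast (hF m n).trans_lt h₁
    exact (Set.ncard_eq_zero ((Set.finite_Iio n).inter_of_right _)).1 (by omega)
  have hsub : ∀ M n : ℕ, (p ∪ ⋃ m, x m) ∩ Set.Iio n ⊆ (p ∩ Set.Iio n) ∪
      ((⋃ m ∈ Finset.range M, x m ∩ Set.Iio n) ∪
        ⋃ m ∈ Finset.Ico M n, (x m \ F m) ∩ Set.Iio n) := by
    rintro M n a ⟨ha, han⟩
    by_cases hap : a ∈ p
    · exact Or.inl ⟨hap, han⟩
    obtain ⟨m, hm⟩ := Set.mem_iUnion.1 (ha.resolve_left hap)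
    have hmem : a ∈ (x m \ F m) ∩ Set.Iio n := ⟨⟨hm, fun h => hap (hFp m h)⟩, han⟩
    right
    rcases lt_or_ge m M with h | h
    · exact Or.inl (Set.mem_biUnion (Finset.mem_coe.2 (Finset.mem_range.2 h)) ⟨hm, han⟩)
    · refine Or.inr (Set.mem_biUnion (Finset.mem_coe.2 (Finset.mem_Ico.2 ⟨h, ?_⟩)) hmem)
      by_contra! hnm
      rw [hempty m n hnm] at hmem
      exact hmem
  have hgeom : ∀ M n : ℕ, ∑ m ∈ Finset.Ico M n, (1 / 2 : ℝ) ^ m ≤ 2 * (1 / 2) ^ M := by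
    intro M n
    have h := geom_sum_Ico_le_of_lt_one (m := M) (n := n) (show (0 : ℝ) ≤ 1 / 2 by norm_num)
      (by norm_num)
    refine h.trans_eq ?_
    norm_num
    ring
  -- For fixed `M`, finitely many sets have vanishing density and the rest cost a geometric tail.
  have hbound : ∀ M n : ℕ, (((p ∪ ⋃ m, x m) ∩ Set.Iio n).ncard : ℝ) / n ≤
      ((p ∩ Set.Iio n).ncard : ℝ) / n +
        ∑ m ∈ Finset.range M, ((x m ∩ Set.Iio n).ncard : ℝ) / n + 2 * (1 / 2) ^ M := by
    intro M n
    rcases Nat.eq_zero_or_pos n with rfl | hn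
    · simp
    have hn' : (0 : ℝ) < n := by exact_mod_cast hn
    have hfin : ((p ∩ Set.Iio n) ∪ ((⋃ m ∈ Finset.range M, x m ∩ Set.Iio n) ∪
        ⋃ m ∈ Finset.Ico M n, (x m \ F m) ∩ Set.Iio n)).Finite :=
      (Set.finite_Iio n).subset (Set.union_subset Set.inter_subset_right
        (Set.union_subset (Set.iUnion₂_subset fun _ _ => Set.inter_subset_right)
          (Set.iUnion₂_subset fun _ _ => Set.inter_subset_right)))
    have h₁ : ((p ∪ ⋃ m, x m) ∩ Set.Iio n).ncard ≤ (p ∩ Set.Iio n).ncard +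
        (∑ m ∈ Finset.range M, (x m ∩ Set.Iio n).ncard +
          ∑ m ∈ Finset.Ico M n, ((x m \ F m) ∩ Set.Iio n).ncard) :=
      (Set.ncard_le_ncard (hsub M n) hfin).trans <| (Set.ncard_union_le _ _).trans <|
        Nat.add_le_add_left ((Set.ncard_union_le _ _).trans
          (Nat.add_le_add (ncard_biUnion_le_sum _ _) (ncard_biUnion_le_sum _ _))) _
    have h₂ : ∑ m ∈ Finset.Ico M n, (((x m \ F m) ∩ Set.Iio n).ncard : ℝ) ≤
        2 * (1 / 2) ^ M * n := by
      refine (Finset.sum_le_sum fun m _ => hF m n).trans ?_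
      rw [← Finset.sum_mul]
      exact mul_le_mul_of_nonneg_right (hgeom M n) hn'.le
    rw [← Finset.sum_div, ← add_div, ← sub_le_iff_le_add, le_div_iff₀ hn', sub_mul,
      div_mul_cancel₀ _ hn'.ne']
    have h₃ : (((p ∪ ⋃ m, x m) ∩ Set.Iio n).ncard : ℝ) ≤ (p ∩ Set.Iio n).ncard +
        (∑ m ∈ Finset.range M, ((x m ∩ Set.Iio n).ncard : ℝ) +
          ∑ m ∈ Finset.Ico M n, (((x m \ F m) ∩ Set.Iio n).ncard : ℝ)) := by exact_mod_cast h₁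
    linarith
  refine tendsto_order.2 ⟨fun a ha => Eventually.of_forall fun n => ha.trans_le (by positivity),
    fun ε hε => ?_⟩
  obtain ⟨M, hM⟩ := exists_pow_lt_of_lt_one (show (0 : ℝ) < ε / 4 by positivity)
    (show (1 / 2 : ℝ) < 1 by norm_num)
  have hlim : Tendsto (fun n : ℕ => ((p ∩ Set.Iio n).ncard : ℝ) / n +
      ∑ m ∈ Finset.range M, ((x m ∩ Set.Iio n).ncard : ℝ) / n) atTop (𝓝 0) := by
    simpa using hp.add (tendsto_finsetSum (Finset.range M) fun m _ => hx m)
  filter_upwards [hlim.eventually_lt_const (show (0 : ℝ) < ε / 2 by positivity)] with n hn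
  linarith [hbound M n]

theorem not_tukeyGE_zZero_sigmaOmega : ¬ TukeyGE ZZero SigmaOmega := by
  refine not_tukeyGE_sigmaOmega_of_countable_family
    (fun i : Finset ℕ × ℕ =>
      {S : ZZero | ∀ n : ℕ, (((S.1 \ i.1) ∩ Set.Iio n).ncard : ℝ) ≤ (1 / 2) ^ i.2 * n})
    fun x p hx => ?_
  choose F hFp hF using p.exists_finset_subset
  obtain ⟨k, hk, hkF⟩ := extraction_forall_of_eventually fun m => hx (F m, m) (hF m)
  refine ⟨k, hk, ⟨_, tendsto_density_union_iUnion p.2 (fun m => (x (k m)).2) hFp hkF⟩, ?_⟩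
  rintro _ ⟨m, rfl⟩
  exact (Set.subset_iUnion (fun m => (x (k m)).1) m).trans Set.subset_union_right

/-! ### Summable sequences -/

theorem EllOne.summable_max_sub (x : EllOne) (F : ℕ →₀ ℚ) :
    Summable fun n => max (x.1 n - F n) 0 := by
  have hF : Summable fun n => |(F n : ℝ)| :=
    summable_of_hasFiniteSupport (F.hasFiniteSupport.subset fun n hn h => hn (by simp [h]))
  refine (x.2.add hF).of_nonneg_of_le (fun n => le_max_right _ _) fun n => max_le ?_ (by positivity)
  linarith [le_abs_self (x.1 n), neg_abs_le (F n : ℝ)]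

/-- Take `F` slightly above `|p|` on a long initial segment and zero after. The bound on `F` is
independent of `m`, so one summable sequence dominates all the `F m` chosen later. -/
theorem EllOne.exists_finsupp (p : EllOne) (m : ℕ) : ∃ F : ℕ →₀ ℚ,
    (∀ n, (F n : ℝ) ≤ |p.1 n| + (1 / 2) ^ n) ∧
      ∑' n, max (p.1 n - F n) 0 ≤ (1 / 2) ^ m := by
  have hr : ∀ n, ∃ r : ℚ, |p.1 n| < r ∧ (r : ℝ) < |p.1 n| + (1 / 2) ^ n := fun n =>
    exists_rat_btwn (by linarith [show (0 : ℝ) < (1 / 2) ^ n by positivity])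
  choose r hr₁ hr₂ using hr
  obtain ⟨N, hN⟩ := ((tendsto_sum_nat_add fun n => |p.1 n|).eventually_lt_const
    (show (0 : ℝ) < (1 / 2) ^ m by positivity)).exists
  let F : ℕ →₀ ℚ := Finsupp.onFinset (Finset.range N) (fun n => if n < N then r n else 0)
    fun n hn => by
      by_contra h
      exact hn (if_neg (by simpa using h))
  have hF₁ : ∀ n, n < N → F n = r n := fun n h => if_pos h
  have hF₂ : ∀ n, ¬ n < N → F n = 0 := fun n h => if_neg h
  refine ⟨F, fun n => ?_, ?_⟩
  · by_cases h : n < N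
    · rw [hF₁ n h]
      exact (hr₂ n).le
    · rw [hF₂ n h, Rat.cast_zero]
      positivity
  · have hs := p.summable_max_sub F
    rw [← hs.sum_add_tsum_nat_add N, Finset.sum_eq_zero, zero_add]
    · refine le_trans (((summable_nat_add_iff N).2 hs).tsum_le_tsum (fun n => ?_)
        ((summable_nat_add_iff N).2 p.2)) hN.le
      rw [hF₂ (n + N) (by omega), Rat.cast_zero, sub_zero]
      exact max_le (le_abs_self _) (abs_nonneg _)
    · intro n hn
      rw [hF₁ n (Finset.mem_range.1 hn)]
      exact max_eq_right (by linarith [hr₁ n, le_abs_self (p.1 n)])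

theorem not_tukeyGE_ellOne_sigmaOmega : ¬ TukeyGE EllOne SigmaOmega := by
  refine not_tukeyGE_sigmaOmega_of_countable_family
    (fun i : (ℕ →₀ ℚ) × ℕ =>
      {x : EllOne | ∑' n, max (x.1 n - i.1 n) 0 ≤ (1 / 2) ^ i.2})
    fun x p hx => ?_
  choose F hFp hF using p.exists_finsupp
  obtain ⟨k, hk, hkF⟩ := extraction_forall_of_eventually fun m => hx (F m, m) (hF m)
  -- The excess of `x (k m)` over `F m` has sum at most `(1 / 2) ^ m`, so all excesses together are
  -- summable and can be added to the bound.
  let w : ℕ × ℕ → ℝ := fun i => max ((x (k i.1)).1 i.2 - F i.1 i.2) 0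
  have hw : 0 ≤ w := fun i => le_max_right _ _
  have hsum : Summable w := by
    refine (summable_prod_of_nonneg hw).2 ⟨fun m => (x (k m)).summable_max_sub (F m), ?_⟩
    exact Summable.of_nonneg_of_le (fun m => tsum_nonneg fun n => hw (m, n)) hkF
      (summable_geometric_of_lt_one (by norm_num) (by norm_num))
  have hsymm := (summable_prod_of_nonneg (f := fun i : ℕ × ℕ => w i.swap) fun i => hw i.swap).1
    hsum.prod_symm
  have hy : Summable fun n => |p.1 n| + (1 / 2 : ℝ) ^ n + ∑' m, w (m, n) :=
    (p.2.add (summable_geometric_of_lt_one (by norm_num) (by norm_num))).add hsymm.2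
  refine ⟨k, hk, ⟨_, hy.abs⟩, ?_⟩
  rintro _ ⟨m, rfl⟩ n
  have h₁ : w (m, n) ≤ ∑' m, w (m, n) := (hsymm.1 n).le_tsum m fun j _ => hw (j, n)
  have h₂ : (x (k m)).1 n - F m n ≤ w (m, n) := le_max_left _ _
  change (x (k m)).1 n ≤ |p.1 n| + (1 / 2 : ℝ) ^ n + ∑' m, w (m, n)
  linarith [hFp m n]

theorem mainTheorem10 :
    (∀ (P : Type u) [PartialOrder P] [IsDirectedOrder P] [Nonempty P] [TopologicalSpace P]
      [SecondCountableTopology P], CSBS P → ¬ TukeyGE P SigmaOmega) ∧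
    ¬ TukeyGE (ℕ → ℕ) SigmaOmega ∧
    ¬ TukeyGE EMu SigmaOmega ∧
    ¬ TukeyGE (NWD (ℕ → Bool)) SigmaOmega ∧
    ¬ TukeyGE (NWD unitInterval) SigmaOmega ∧
    ¬ TukeyGE (NWD ℝ) SigmaOmega ∧
    ¬ TukeyGE ZZero SigmaOmega ∧
    ¬ TukeyGE EllOne SigmaOmega ∧
    TukeyGE SigmaOmega (ℕ → ℕ) :=
  ⟨fun _ _ _ _ _ _ hP => hP.not_tukeyGE_sigmaOmega, csbs_nat_pi.not_tukeyGE_sigmaOmega,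
    not_tukeyGE_eMu_sigmaOmega, not_tukeyGE_nwd_sigmaOmega _, not_tukeyGE_nwd_sigmaOmega _,
    not_tukeyGE_nwd_sigmaOmega _, not_tukeyGE_zZero_sigmaOmega, not_tukeyGE_ellOne_sigmaOmega,
    tukeyGE_sigmaOmega_nat_pi⟩
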